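/- Let $\lambda=(\lambda_n)_{n\ge 1}$ be a frequency, i.e. a strictly increasing sequence of non-negative real numbers tending to $\infty$. A $\lambda$-Dirichlet group is a pair $(G,\beta)$ where $G$ is a compact abelian group and $\beta\colon\mathbb R\to G$ is a continuous homomorphism with dense range such that for every $n$ there is a (necessarily unique) character $h_{\lambda_n}\in\widehat G$ with $h_{\lambda_n}(\beta(t))=e^{-i\lambda_n t}$ for all $t\in\mathbb R$. For $1\le p\le\infty$ let $H_p^\lambda(G)$ be the space of all $f\in L_p(G)$ (with respect to normalised Haar measure) whose Fourier coefficients $\widehat f(\gamma)$, $\gamma\in\widehat G$, vanish unless $\gamma\in\{h_{\lambda_n}: n\in\mathbb N\}$. The Hardy space $\mathcal H_p(\lambda)$ consists of all formal Dirichlet series $D=\sum a_ne^{-\lambda_n s}$ for which there is $f\in H_p^\lambda(G)$ with $a_n=\widehat f(h_{\lambda_n})$ for all $n$, with norm $\|D\|_p=\|f\|_p$. For $N\ge1$ let $$\pi^N_p\colon \mathcal H_p(\lambda)\to\mathcal H_p(\lambda),\qquad \sum a_ne^{-\lambda_ns}\mapsto\sum_{n=1}^N a_ne^{-\lambda_ns}.$$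 Consider the conditions $$(BC)\quad \exists\, l>0\ \forall\,\delta>0\ \exists\, C>0\ \forall\, n:\ \lambda_{n+1}-\lambda_n\ge Ce^{-(l+\delta)\lambda_n},$$ $$(LC)\quad \forall\,\delta>0\ \exists\, C>0\ \forall\, n:\ \lambda_{n+1}-\lambda_n\ge Ce^{-e^{\delta\lambda_n}},$$ and let $L(\lambda)=\sup_{D}\big(\sigma_a(D)-\sigma_c(D)\big)\in[0,\infty]$ be the maximal width of the strip of convergence and non-absolute convergence of $\lambda$-Dirichlet series $D$, where $\sigma_c(D)$ and $\sigma_a(D)$ are the abscissas of convergence and of absolute convergence of $D$, and the supremum is over those $D$ for which the difference is defined in $[-\infty,\infty]$. Then the following holds for $p=1$ and for $p=\infty$. (1) If $\lambda$ satisfies (BC), then there is a constant $C=C(\lambda)>0$ such that for every $\lambda$-Dirichlet group and all $N$ with $\lambda_N>0$ (that is, all $N\ge 1$ if $\lambda_1>0$, and all $N\ge2$ if $\lambda_1=0$) $$\|\pi^N_p\colon\mathcal H_p(\lambda)\to\mathcal H_p(\lambda)\|\le C\lambda_N .$$ (2) If $\lambda$ satisfies (LC) and $L(\lambda)<\infty$,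 then for every $\delta>0$ there is a constant $C_1=C_1(\delta,\lambda)>0$ such that for every $\lambda$-Dirichlet group and all $N\ge 1$ $$\|\pi^N_p\colon\mathcal H_p(\lambda)\to\mathcal H_p(\lambda)\|\le C_1e^{\delta\lambda_N}.$$ -/

import Mathlib

open MeasureTheory Filter Topology
open scoped ENNReal ComplexConjugate

namespace GeneralDirichlet

noncomputable section

/-! ### Frequencies, formal Dirichlet series, abscissas -/

/-- A frequency: a strictly increasing sequence of non-negative reals tending to infinity.
Sequences are indexed from `0`, so `lam n` is the `(n+1)`-st frequency. -/
structure IsFrequency (lam : ℕ → ℝ) : Prop where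
  strictMono : StrictMono lam
  nonneg : ∀ n, 0 ≤ lam n
  tendsto_atTop : Tendsto lam atTop atTop

/-- Bohr's condition (BC). -/
def BohrCondition (lam : ℕ → ℝ) : Prop :=
  ∃ l : ℝ, 0 < l ∧ ∀ δ : ℝ, 0 < δ → ∃ C : ℝ, 0 < C ∧
    ∀ n, C * Real.exp (-(l + δ) * lam n) ≤ lam (n + 1) - lam n

/-- Landau's condition (LC). -/
def LandauCondition (lam : ℕ → ℝ) : Prop :=
  ∀ δ : ℝ, 0 < δ → ∃ C : ℝ, 0 < C ∧
    ∀ n, C * Real.exp (-Real.exp (δ * lam n)) ≤ lam (n + 1) - lam n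

/-- The `n`-th term `a_n e^{-λ_n s}` of the general Dirichlet series with coefficients `a`. -/
def dirichletTerm (lam : ℕ → ℝ) (a : ℕ → ℂ) (s : ℂ) (n : ℕ) : ℂ :=
  a n * Complex.exp (-(lam n : ℂ) * s)

/-- The abscissa of convergence of `∑ a_n e^{-λ_n s}`, as an extended real. -/
def abscissaConv (lam : ℕ → ℝ) (a : ℕ → ℂ) : EReal :=
  sInf ((fun σ : ℝ => (σ : EReal)) '' {σ : ℝ | ∀ s : ℂ, σ < s.re →
    ∃ S : ℂ, Tendsto (fun N => ∑ n ∈ Finset.range N, dirichletTerm lam a s n) atTop (𝓝 S)})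

/-- The abscissa of absolute convergence of `∑ a_n e^{-λ_n s}`, as an extended real. -/
def abscissaAbsConv (lam : ℕ → ℝ) (a : ℕ → ℂ) : EReal :=
  sInf ((fun σ : ℝ => (σ : EReal)) '' {σ : ℝ | ∀ s : ℂ, σ < s.re →
    Summable (fun n => ‖dirichletTerm lam a s n‖)})

/-- `L(λ)`, the maximal width of the strip of convergence and non absolute convergence.
In `EReal` one has `⊤ - ⊤ = ⊥ - ⊥ = ⊥`, so the series for which the difference is indeterminate
(nowhere convergent, or everywhere absolutely convergent) do not contribute to the supremum. -/
def stripWidth (lam : ℕ → ℝ) : EReal :=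
  ⨆ a : ℕ → ℂ, abscissaAbsConv lam a - abscissaConv lam a

/-! ### Fourier analysis on compact abelian groups -/

section Group

variable (G : Type*) [CommGroup G] [TopologicalSpace G] [IsTopologicalGroup G] [CompactSpace G]
  [MeasurableSpace G] [BorelSpace G]

/-- The normalised Haar measure of a compact group. -/
def haarProb : Measure G := Measure.haarMeasure ⊤

instance : (haarProb G).IsHaarMeasure := by
  unfold haarProb; infer_instance

instance : IsProbabilityMeasure (haarProb G) :=
  ⟨by
    have h := Measure.haarMeasure_self (G := G) (K₀ := ⊤)
    rwa [TopologicalSpace.PositiveCompacts.coe_top] at h⟩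

variable {G}

/-- The Fourier coefficient `∫ f(ω) conj(γ(ω)) dω` at the character `γ`. -/
def fourierCoeff (f : G → ℂ) (γ : PontryaginDual G) : ℂ :=
  ∫ ω, f ω * conj (γ ω : ℂ) ∂(haarProb G)

lemma norm_char (γ : PontryaginDual G) (ω : G) : ‖(γ ω : ℂ)‖ = 1 := Circle.norm_coe _

lemma char_mul_conj (γ : PontryaginDual G) (ω : G) : (γ ω : ℂ) * conj (γ ω : ℂ) = 1 := by
  rw [Complex.mul_conj, Complex.normSq_eq_norm_sq, norm_char]
  norm_num

lemma continuous_char (γ : PontryaginDual G) : Continuous (fun ω => (γ ω : ℂ)) :=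
  continuous_subtype_val.comp (map_continuous γ)

lemma integrable_mul_char {p : ℝ≥0∞} [hp : Fact (1 ≤ p)] (f : Lp ℂ p (haarProb G))
    (γ : PontryaginDual G) :
    Integrable (fun ω => f ω * conj (γ ω : ℂ)) (haarProb G) := by
  have h1 : Integrable (f : G → ℂ) (haarProb G) := (Lp.memLp f).integrable hp.out
  refine h1.mul_bdd (c := 1) ?_ ?_
  · exact (Complex.continuous_conj.comp (continuous_char γ)).aestronglyMeasurable
  · exact Eventually.of_forall fun ω => by rw [RCLike.norm_conj, norm_char]

lemma norm_fourierCoeff_le {p : ℝ≥0∞} [hp : Fact (1 ≤ p)] (f : Lp ℂ p (haarProb G))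
    (γ : PontryaginDual G) : ‖fourierCoeff (f : G → ℂ) γ‖ ≤ ‖f‖ := by
  have hm := Lp.memLp f
  have h1 : ‖fourierCoeff (f : G → ℂ) γ‖ ≤ ∫ ω, ‖f ω‖ ∂(haarProb G) := by
    refine (norm_integral_le_integral_norm _).trans (le_of_eq ?_)
    simp only [norm_mul, RCLike.norm_conj, norm_char, mul_one]
  have h2 : ∫ ω, ‖f ω‖ ∂(haarProb G) = (eLpNorm (f : G → ℂ) 1 (haarProb G)).toReal := by
    rw [integral_norm_eq_lintegral_enorm hm.1, eLpNorm_one_eq_lintegral_enorm]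
  rw [h2] at h1
  refine h1.trans ?_
  rw [Lp.norm_def]
  exact ENNReal.toReal_mono hm.2.ne (eLpNorm_le_eLpNorm_of_exponent_le hp.out hm.1)

/-- `f ↦ f̂(γ)` as a continuous linear functional on `L_p(G)`. -/
def fourierCoeffCLM (p : ℝ≥0∞) [Fact (1 ≤ p)] (γ : PontryaginDual G) :
    Lp ℂ p (haarProb G) →L[ℂ] ℂ :=
  LinearMap.mkContinuous
    { toFun := fun f => fourierCoeff (f : G → ℂ) γ
      map_add' := fun f g => by
        unfold fourierCoeff
        rw [← integral_add (integrable_mul_char f γ) (integrable_mul_char g γ)]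
        refine integral_congr_ae ?_
        filter_upwards [Lp.coeFn_add f g] with ω h
        rw [h, Pi.add_apply, add_mul]
      map_smul' := fun c f => by
        unfold fourierCoeff
        rw [RingHom.id_apply, smul_eq_mul, ← integral_const_mul]
        refine integral_congr_ae ?_
        filter_upwards [Lp.coeFn_smul c f] with ω h
        rw [h, Pi.smul_apply, smul_eq_mul, mul_assoc] }
    1 (fun f => by simpa using norm_fourierCoeff_le f γ)

@[simp] lemma fourierCoeffCLM_apply (p : ℝ≥0∞) [Fact (1 ≤ p)] (γ : PontryaginDual G)
    (f : Lp ℂ p (haarProb G)) : fourierCoeffCLM p γ f = fourierCoeff (f : G → ℂ) γ := rfl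

/-- `H_p^E(G)`: the functions in `L_p(G)` whose Fourier transform is supported in `E`. -/
def groupHardy (p : ℝ≥0∞) [Fact (1 ≤ p)] (E : Set (PontryaginDual G)) :
    Submodule ℂ (Lp ℂ p (haarProb G)) where
  carrier := {f | ∀ γ, fourierCoeff (f : G → ℂ) γ ≠ 0 → γ ∈ E}
  zero_mem' := fun γ h => absurd (map_zero (fourierCoeffCLM p γ)) h
  add_mem' := fun {f g} hf hg γ h => by
    by_contra hγ
    have h1 : fourierCoeffCLM p γ f = 0 := by_contra fun h' => hγ (hf γ h')
    have h2 : fourierCoeffCLM p γ g = 0 := by_contra fun h' => hγ (hg γ h')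
    exact h (show fourierCoeffCLM p γ (f + g) = 0 by rw [map_add, h1, h2, add_zero])
  smul_mem' := fun c f hf γ h => by
    by_contra hγ
    have h1 : fourierCoeffCLM p γ f = 0 := by_contra fun h' => hγ (hf γ h')
    exact h (show fourierCoeffCLM p γ (c • f) = 0 by rw [map_smul, h1, smul_zero])

open Classical in
/-- Distinct characters are orthogonal, and characters have norm one in `L_2`. -/
lemma fourierCoeff_char (χ γ : PontryaginDual G) :
    fourierCoeff (fun ω => (χ ω : ℂ)) γ = if χ = γ then 1 else 0 := by
  unfold fourierCoeff
  split_ifs with h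
  · subst h
    simp only [char_mul_conj]
    simp
  · obtain ⟨x, hx⟩ : ∃ x, χ x ≠ γ x := by
      by_contra hc
      push Not at hc
      exact h (PontryaginDual.ext hc)
    set I := ∫ ω, (χ ω : ℂ) * conj (γ ω : ℂ) ∂(haarProb G) with hI
    have key : I = ((χ x : ℂ) * conj (γ x : ℂ)) * I := by
      conv_lhs => rw [hI, ← integral_mul_left_eq_self _ x]
      rw [hI, ← integral_const_mul]
      refine integral_congr_ae (Eventually.of_forall fun ω => ?_)
      simp only [map_mul, Circle.coe_mul]
      ring
    by_contra hI0
    have h1 : (χ x : ℂ) * conj (γ x : ℂ) = 1 :=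
      (mul_right_cancel₀ hI0 (by rw [one_mul]; exact key)).symm
    apply hx
    have h2 : conj (γ x : ℂ) * (γ x : ℂ) = 1 := by rw [mul_comm, char_mul_conj]
    apply Circle.ext
    calc (χ x : ℂ) = (χ x : ℂ) * (conj (γ x : ℂ) * (γ x : ℂ)) := by rw [h2, mul_one]
      _ = (γ x : ℂ) := by rw [← mul_assoc, h1, one_mul]

lemma memLp_char (p : ℝ≥0∞) (χ : PontryaginDual G) :
    MemLp (fun ω => (χ ω : ℂ)) p (haarProb G) :=
  MemLp.of_bound (continuous_char χ).aestronglyMeasurable 1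
    (Eventually.of_forall fun ω => (norm_char χ ω).le)

/-- The character `χ` as an element of `L_p(G)`. -/
def charLp (p : ℝ≥0∞) (χ : PontryaginDual G) : Lp ℂ p (haarProb G) :=
  (memLp_char p χ).toLp _

open Classical in
lemma fourierCoeff_charLp (p : ℝ≥0∞) (χ γ : PontryaginDual G) :
    fourierCoeff (charLp p χ : G → ℂ) γ = if χ = γ then 1 else 0 := by
  rw [← fourierCoeff_char]
  unfold fourierCoeff charLp
  refine integral_congr_ae ?_
  filter_upwards [(memLp_char p χ).coeFn_toLp] with ω h
  rw [h]

end Group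

/-! ### `λ`-Dirichlet groups -/

/-- A `λ`-Dirichlet group structure on the compact abelian group `G`: a continuous homomorphism
`β : ℝ → G` with dense range such that each character `t ↦ e^{-iλ_n t}` of `ℝ` extends along `β` to
a character of `G`. (The additive group `ℝ` is written multiplicatively, as `G` is.) -/
structure DirichletGroup (lam : ℕ → ℝ) (G : Type*) [CommGroup G] [TopologicalSpace G] where
  β : Multiplicative ℝ →ₜ* G
  denseRange : DenseRange β
  exists_char : ∀ n, ∃ γ : PontryaginDual G,
    ∀ t : ℝ, γ (β (Multiplicative.ofAdd t)) = Circle.exp (-(lam n * t))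

namespace DirichletGroup

variable {lam : ℕ → ℝ} {G : Type*} [CommGroup G] [TopologicalSpace G]

/-- The (unique) character `h_{λ_n}` of `G` with `h_{λ_n} ∘ β = e^{-iλ_n ·}`. -/
def char (B : DirichletGroup lam G) (n : ℕ) : PontryaginDual G := (B.exists_char n).choose

lemma char_spec (B : DirichletGroup lam G) (n : ℕ) (t : ℝ) :
    B.char n (B.β (Multiplicative.ofAdd t)) = Circle.exp (-(lam n * t)) :=
  (B.exists_char n).choose_spec t

lemma eq_char (B : DirichletGroup lam G) (n : ℕ) (γ : PontryaginDual G)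
    (h : ∀ t : ℝ, γ (B.β (Multiplicative.ofAdd t)) = Circle.exp (-(lam n * t))) :
    γ = B.char n := by
  apply PontryaginDual.ext
  intro a
  refine congrFun (B.denseRange.equalizer (map_continuous γ) (map_continuous (B.char n)) ?_) a
  funext t
  exact (h (Multiplicative.toAdd t)).trans (B.char_spec n (Multiplicative.toAdd t)).symm

lemma char_injective (B : DirichletGroup lam G) (hlam : Function.Injective lam) :
    Function.Injective B.char := by
  intro m n hmn
  by_contra hne
  have hd : lam n - lam m ≠ 0 := fun h => hne (hlam (sub_eq_zero.mp h).symm)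
  have h1 : Circle.exp (-(lam m * (Real.pi / (lam n - lam m))))
      = Circle.exp (-(lam n * (Real.pi / (lam n - lam m)))) := by
    rw [← B.char_spec m, ← B.char_spec n, hmn]
  have h2 : -(lam m * (Real.pi / (lam n - lam m)))
      = -(lam n * (Real.pi / (lam n - lam m))) + Real.pi := by
    field_simp
    ring
  rw [h2, Circle.exp_add] at h1
  have h3 := congrArg (fun z : Circle => (z : ℂ)) (mul_eq_left.mp h1)
  rw [Circle.coe_exp, Complex.exp_pi_mul_I] at h3
  norm_num at h3

end DirichletGroup

/-! ### The Hardy spaces `𝓗_p(λ)` and the partial sum operators -/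

section Hardy

variable {lam : ℕ → ℝ} {G : Type*} [CommGroup G] [TopologicalSpace G] [IsTopologicalGroup G]
  [CompactSpace G] [MeasurableSpace G] [BorelSpace G]

/-- `H_p^λ(G)`. -/
abbrev lamHardy (B : DirichletGroup lam G) (p : ℝ≥0∞) [Fact (1 ≤ p)] :
    Submodule ℂ (Lp ℂ p (haarProb G)) :=
  groupHardy p (Set.range B.char)

/-- The Bohr map, sending `f ∈ H_p^λ(G)` to the formal Dirichlet series `∑ f̂(h_{λ_n}) e^{-λ_n s}`;
a formal `λ`-Dirichlet series is identified with its sequence of coefficients. -/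
def bohrMap (B : DirichletGroup lam G) (p : ℝ≥0∞) [Fact (1 ≤ p)] :
    lamHardy B p →ₗ[ℂ] (ℕ → ℂ) :=
  LinearMap.pi fun n => (fourierCoeffCLM p (B.char n)).toLinearMap ∘ₗ (lamHardy B p).subtype

lemma bohrMap_apply (B : DirichletGroup lam G) (p : ℝ≥0∞) [Fact (1 ≤ p)] (f : lamHardy B p)
    (n : ℕ) : bohrMap B p f n = fourierCoeff (f : G → ℂ) (B.char n) := rfl

lemma continuous_bohrMap (B : DirichletGroup lam G) (p : ℝ≥0∞) [Fact (1 ≤ p)] :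
    Continuous (bohrMap B p) :=
  continuous_pi fun n => (fourierCoeffCLM p (B.char n)).continuous.comp continuous_subtype_val

instance isClosed_ker_bohrMap (B : DirichletGroup lam G) (p : ℝ≥0∞) [Fact (1 ≤ p)] :
    IsClosed ((LinearMap.ker (bohrMap B p) : Submodule ℂ (lamHardy B p)) : Set (lamHardy B p)) :=
  isClosed_singleton.preimage (continuous_bohrMap B p)

/-- The Hardy space `𝓗_p(λ)` of `λ`-Dirichlet series: all `∑ a_n e^{-λ_n s}` for which there is
`f ∈ H_p^λ(G)` with `a_n = f̂(h_{λ_n})` for all `n`. -/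
def HardySpace (B : DirichletGroup lam G) (p : ℝ≥0∞) [Fact (1 ≤ p)] : Type :=
  LinearMap.range (bohrMap B p)

instance (B : DirichletGroup lam G) (p : ℝ≥0∞) [Fact (1 ≤ p)] :
    AddCommGroup (HardySpace B p) :=
  inferInstanceAs (AddCommGroup (LinearMap.range (bohrMap B p)))

instance (B : DirichletGroup lam G) (p : ℝ≥0∞) [Fact (1 ≤ p)] :
    Module ℂ (HardySpace B p) :=
  inferInstanceAs (Module ℂ (LinearMap.range (bohrMap B p)))

namespace HardySpace

variable (B : DirichletGroup lam G) (p : ℝ≥0∞) [Fact (1 ≤ p)]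

/-- The sequence of Dirichlet coefficients of an element of `𝓗_p(λ)`. -/
def coeff : HardySpace B p →ₗ[ℂ] (ℕ → ℂ) :=
  (LinearMap.range (bohrMap B p)).subtype

variable {B p} in
@[ext] lemma ext {D E : HardySpace B p} (h : ∀ n, coeff B p D n = coeff B p E n) : D = E :=
  Subtype.ext (funext h)

/-- The Dirichlet series of `f ∈ H_p^λ(G)`, as an element of `𝓗_p(λ)`. -/
def ofFun : lamHardy B p →ₗ[ℂ] HardySpace B p := (bohrMap B p).rangeRestrict

@[simp] lemma coeff_ofFun (f : lamHardy B p) (n : ℕ) :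
    coeff B p (ofFun B p f) n = fourierCoeff (f : G → ℂ) (B.char n) := rfl

lemma ofFun_surjective : Function.Surjective (ofFun B p) :=
  (bohrMap B p).surjective_rangeRestrict

/-- `𝓗_p(λ)` as the quotient of `H_p^λ(G)` by the kernel of the Bohr map. -/
def toQuotient : HardySpace B p ≃ₗ[ℂ] (lamHardy B p ⧸ LinearMap.ker (bohrMap B p)) :=
  (bohrMap B p).quotKerEquivRange.symm

/-- The norm `‖D‖_p = ‖f‖_p`, where `f ∈ H_p^λ(G)` is the function with Dirichlet series `D`.
The Bohr map is injective, because a function on a compact abelian group is determined by its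
Fourier coefficients; the norm is nevertheless introduced as the infimum of `‖f‖_p` over all
such `f` (see `isGLB_norm`), which needs no uniqueness. -/
instance : NormedAddCommGroup (HardySpace B p) :=
  NormedAddCommGroup.induced (HardySpace B p) (lamHardy B p ⧸ LinearMap.ker (bohrMap B p))
    (toQuotient B p) (toQuotient B p).injective

instance : NormedSpace ℂ (HardySpace B p) :=
  NormedSpace.induced ℂ (HardySpace B p) (lamHardy B p ⧸ LinearMap.ker (bohrMap B p))
    (toQuotient B p)

lemma toQuotient_ofFun (f : lamHardy B p) :
    toQuotient B p (ofFun B p f) = Submodule.Quotient.mk f :=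
  (bohrMap B p).quotKerEquivRange.symm_apply_apply (Submodule.Quotient.mk f)

lemma isGLB_norm (D : HardySpace B p) :
    IsGLB {r : ℝ | ∃ f : lamHardy B p, ofFun B p f = D ∧ ‖f‖ = r} ‖D‖ := by
  have hn : ‖D‖ = ‖toQuotient B p D‖ := rfl
  have hmk : ∀ f : lamHardy B p, (Submodule.Quotient.mk f = toQuotient B p D) ↔
      ofFun B p f = D := fun f => by
    rw [← toQuotient_ofFun, (toQuotient B p).injective.eq_iff]
  rw [isGLB_iff_le_iff]
  intro b
  rw [hn]
  have := QuotientAddGroup.le_norm_iff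
    (S := (LinearMap.ker (bohrMap B p)).toAddSubgroup) (r := b) (x := toQuotient B p D)
  refine this.trans ⟨?_, ?_⟩
  · rintro h r ⟨f, hf, rfl⟩
    exact h f ((hmk f).2 hf)
  · intro h f hf
    exact h ⟨f, (hmk f).1 hf, rfl⟩

lemma norm_coeff_le (D : HardySpace B p) (n : ℕ) : ‖coeff B p D n‖ ≤ ‖D‖ := by
  refine (le_isGLB_iff (isGLB_norm B p D)).2 ?_
  rintro r ⟨f, rfl, rfl⟩
  rw [coeff_ofFun]
  exact norm_fourierCoeff_le (f : Lp ℂ p (haarProb G)) (B.char n)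

/-- The `n`-th Dirichlet coefficient as a continuous linear functional. -/
def coeffCLM (n : ℕ) : HardySpace B p →L[ℂ] ℂ :=
  LinearMap.mkContinuous (LinearMap.proj n ∘ₗ coeff B p) 1
    (fun D => by simpa using norm_coeff_le B p D n)

@[simp] lemma coeffCLM_apply (n : ℕ) (D : HardySpace B p) :
    coeffCLM B p n D = coeff B p D n := rfl

lemma charLp_mem (n : ℕ) : charLp p (B.char n) ∈ lamHardy B p := by
  intro γ hγ
  rw [fourierCoeff_charLp] at hγ
  exact ⟨n, by_contra fun h => hγ (if_neg h)⟩

/-- The monomial `e^{-λ_n s}`, the Dirichlet series of the character `h_{λ_n}`. -/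
def monomial (n : ℕ) : HardySpace B p := ofFun B p ⟨charLp p (B.char n), charLp_mem B p n⟩

lemma coeff_monomial (hlam : Function.Injective lam) (n k : ℕ) :
    coeff B p (monomial B p n) k = if n = k then 1 else 0 := by
  unfold monomial
  rw [coeff_ofFun]
  refine (fourierCoeff_charLp p (B.char n) (B.char k)).trans ?_
  simp [(B.char_injective hlam).eq_iff]

/-- The partial sum operator `∑ a_n e^{-λ_n s} ↦ ∑_{n ≤ N} a_n e^{-λ_n s}` on `𝓗_p(λ)`.
Indices start at `0`; the sum runs over the frequencies up to and including `lam N`. -/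
def partialSum (N : ℕ) : HardySpace B p →L[ℂ] HardySpace B p :=
  ∑ n ∈ Finset.range (N + 1), (coeffCLM B p n).smulRight (monomial B p n)

lemma partialSum_apply (N : ℕ) (D : HardySpace B p) :
    partialSum B p N D = ∑ n ∈ Finset.range (N + 1), coeff B p D n • monomial B p n := by
  simp [partialSum]

lemma coeff_partialSum (hlam : Function.Injective lam) (N : ℕ) (D : HardySpace B p) (k : ℕ) :
    coeff B p (partialSum B p N D) k = if k ≤ N then coeff B p D k else 0 := by
  rw [partialSum_apply, map_sum, Finset.sum_apply]
  simp only [map_smul, Pi.smul_apply, coeff_monomial B p hlam, smul_eq_mul, mul_ite, mul_one,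
    mul_zero, Finset.sum_ite_eq', Finset.mem_range, Nat.lt_succ_iff]

end HardySpace

end Hardy

end

end GeneralDirichlet

open GeneralDirichlet

namespace GeneralDirichlet

noncomputable section

/-! ### A de la Vallée-Poussin kernel on the real line -/

/-! A partial sum operator is convolution along the flow `β` with a function `φ ∈ L₁(ℝ)`. Such a
convolution multiplies the coefficient at `h_{λ_n}` by `∫ φ(t) e^{iλ_n t} dt`
(`fourierCoeff_flowConv`), and, Haar measure being invariant, its norm on `L_1(G)` and `L_∞(G)` is
at most `‖φ‖₁`, whatever the group. So it suffices to find `φ` of small `L₁` norm whose transform is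
`1` up to `λ_N` and `0` from the next frequency on.

A trapezoid equal to `1` on `[-a, a]` and `0` off `[-b, b]`, with `a = λ_N` and `b` in the gap, does
this. It is a difference of two Fejér triangles, so its kernel is a multiple of `(cos at - cos
bt)/t²`, with `L₁` norm `O(1 + log((a+b)/(b-a)))` (`integral_norm_trapezoidKernel_le`). The gap thus
enters only through its logarithm: a gap `≥ c e^{-E}` costs `O(1 + λ_N + E)` for fixed `c`
(`norm_partialSum_le_of_gap`). Under (BC) `E` is linear in `λ_N`, under (LC) it is `e^{δλ_N}`. -/

lemma one_sub_cos_mul_div_sq_le (x t : ℝ) :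
    (1 - Real.cos (x * t)) / t ^ 2 ≤ (x ^ 2 / 2 + 2) * (1 + t ^ 2)⁻¹ := by
  rcases eq_or_ne t 0 with rfl | ht
  · simp only [ne_eq, OfNat.ofNat_ne_zero, not_false_eq_true, zero_pow, div_zero]
    positivity
  have h1 : 1 - Real.cos (x * t) ≤ x ^ 2 / 2 * t ^ 2 := by
    linarith [Real.one_sub_sq_div_two_le_cos (x := x * t), mul_pow x t 2]
  have h2 : 1 - Real.cos (x * t) ≤ 2 := by linarith [Real.neg_one_le_cos (x * t)]
  have ht2 : 0 < t ^ 2 := by positivity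
  rw [← div_eq_mul_inv, div_le_div_iff₀ ht2 (by positivity)]
  nlinarith [mul_le_mul_of_nonneg_right h2 ht2.le]

lemma integrable_one_sub_cos_mul_div_sq (x : ℝ) :
    Integrable fun t : ℝ => (1 - Real.cos (x * t)) / t ^ 2 := by
  refine (integrable_inv_one_add_sq.const_mul (x ^ 2 / 2 + 2)).mono'
    (Measurable.aestronglyMeasurable (by fun_prop)) (Eventually.of_forall fun t => ?_)
  rw [Real.norm_of_nonneg (div_nonneg (sub_nonneg.2 (Real.cos_le_one _)) (sq_nonneg t))]
  exact one_sub_cos_mul_div_sq_le x t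

/-- The constant `∫ (1 - cos t) / t² dt`. -/
def fejerMass : ℝ := ∫ t : ℝ, (1 - Real.cos t) / t ^ 2

/-- Substitute `x * t`. This produces the piecewise linear function `|x|` from which the trapezoid
is assembled; the value of `fejerMass` is never needed, only its positivity. -/
lemma integral_one_sub_cos_mul_div_sq (x : ℝ) :
    ∫ t : ℝ, (1 - Real.cos (x * t)) / t ^ 2 = |x| * fejerMass := by
  rcases eq_or_ne x 0 with rfl | hx
  · simp
  have h := Measure.integral_comp_mul_left (fun t : ℝ => (1 - Real.cos t) / t ^ 2) x
  have h2 : ∀ t : ℝ, (1 - Real.cos (x * t)) / t ^ 2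
      = x ^ 2 * ((1 - Real.cos (x * t)) / (x * t) ^ 2) := fun t => by
    rw [mul_pow, ← mul_div_assoc, mul_div_mul_left _ _ (pow_ne_zero 2 hx)]
  simp_rw [h2]
  rw [integral_const_mul, h, fejerMass, smul_eq_mul, abs_inv, ← sq_abs x]
  have : |x| ≠ 0 := abs_ne_zero.2 hx
  field_simp

lemma fejerMass_pos : 0 < fejerMass := by
  have hint : Integrable fun t : ℝ => (1 - Real.cos t) / t ^ 2 := by
    simpa using integrable_one_sub_cos_mul_div_sq 1
  have hnn : ∀ t : ℝ, 0 ≤ (1 - Real.cos t) / t ^ 2 := fun t =>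
    div_nonneg (sub_nonneg.2 (Real.cos_le_one _)) (sq_nonneg t)
  refine (integral_pos_iff_support_of_nonneg hnn hint).2 ?_
  refine lt_of_lt_of_le ?_ (measure_mono (s := Set.Ioo 0 1) ?_)
  · simp
  · intro t ht
    have h1 : Real.cos t < 1 := by
      simpa using Real.cos_lt_cos_of_nonneg_of_le_pi_div_two le_rfl
        (by linarith [Real.pi_gt_three, ht.2]) ht.1
    exact (div_pos (sub_pos.2 h1) (pow_pos ht.1 2)).ne'

/-- The kernel whose Fourier transform is the trapezoidal function which equals `1` on `[-a, a]` and
vanishes off `[-b, b]`. -/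
def trapezoidKernel (a b t : ℝ) : ℝ :=
  (Real.cos (a * t) - Real.cos (b * t)) / t ^ 2 / (fejerMass * (b - a))

lemma integrable_cos_sub_cos_div_sq (a b : ℝ) :
    Integrable fun t : ℝ => (Real.cos (a * t) - Real.cos (b * t)) / t ^ 2 := by
  refine ((integrable_one_sub_cos_mul_div_sq b).sub (integrable_one_sub_cos_mul_div_sq a)).congr
    (Eventually.of_forall fun t => ?_)
  simp only [Pi.sub_apply]
  ring

lemma integrable_trapezoidKernel (a b : ℝ) : Integrable (trapezoidKernel a b) :=
  (integrable_cos_sub_cos_div_sq a b).div_const _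

/-- Product-to-sum formulas turn the integrand into four terms `(1 - cos(yt))/t²` with `y = b ± x, a
± x`, each integrating to `|y| * fejerMass`. -/
lemma integral_trapezoidKernel_mul_cos {a b : ℝ} (ha : 0 ≤ a) (hab : a < b) {x : ℝ} (hx : 0 ≤ x) :
    ∫ t, trapezoidKernel a b t * Real.cos (x * t)
      = (b - a + |b - x| - |a - x|) / (2 * (b - a)) := by
  have hK := fejerMass_pos
  have hba : 0 < b - a := sub_pos.2 hab
  have e : ∀ t, trapezoidKernel a b t * Real.cos (x * t) =
      ((1 - Real.cos ((b + x) * t)) / t ^ 2 + (1 - Real.cos ((b - x) * t)) / t ^ 2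
        - ((1 - Real.cos ((a + x) * t)) / t ^ 2 + (1 - Real.cos ((a - x) * t)) / t ^ 2))
      / (2 * (fejerMass * (b - a))) := fun t => by
    unfold trapezoidKernel
    generalize fejerMass * (b - a) = D
    simp only [add_mul, sub_mul, Real.cos_add, Real.cos_sub]
    ring
  simp_rw [e]
  have hi := integrable_one_sub_cos_mul_div_sq
  have hi₂ : ∀ y z : ℝ, Integrable fun t : ℝ =>
      (1 - Real.cos (y * t)) / t ^ 2 + (1 - Real.cos (z * t)) / t ^ 2 :=
    fun y z => (hi y).add (hi z)
  rw [integral_div, integral_sub (hi₂ _ _) (hi₂ _ _),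
    integral_add (hi _) (hi _), integral_add (hi _) (hi _)]
  simp only [integral_one_sub_cos_mul_div_sq]
  rw [abs_of_nonneg (by linarith : 0 ≤ b + x), abs_of_nonneg (by linarith : 0 ≤ a + x)]
  field_simp
  ring

lemma integrable_ofReal_trapezoidKernel (a b : ℝ) :
    Integrable fun t => (trapezoidKernel a b t : ℂ) :=
  (integrable_trapezoidKernel a b).ofReal

lemma trapezoidKernel_neg (a b t : ℝ) : trapezoidKernel a b (-t) = trapezoidKernel a b t := by
  simp [trapezoidKernel]

lemma integral_trapezoidKernel_mul_exp {a b : ℝ} (ha : 0 ≤ a) (hab : a < b) {x : ℝ} (hx : 0 ≤ x) :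
    ∫ t, (trapezoidKernel a b t : ℂ) * Complex.exp ((x * t : ℝ) * Complex.I)
      = ((b - a + |b - x| - |a - x|) / (2 * (b - a)) : ℝ) := by
  rw [← integral_trapezoidKernel_mul_cos ha hab hx, ← integral_complex_ofReal]
  set F : ℝ → ℂ := fun t => (trapezoidKernel a b t : ℂ) * Complex.exp ((x * t : ℝ) * Complex.I)
  have hF : Integrable F := by
    refine (integrable_ofReal_trapezoidKernel a b).mul_bdd (c := 1)
      (Continuous.aestronglyMeasurable (by fun_prop)) (Eventually.of_forall fun t => ?_)
    rw [Complex.norm_exp_ofReal_mul_I]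
  have h1 : ∫ t, F (-t) = ∫ t, F t := integral_neg_eq_self F volume
  -- The kernel is even, so symmetrising in `t` removes the sine part.
  have h2 : ∫ t, F t = (1 / 2 : ℂ) * ∫ t, (F t + F (-t)) := by
    rw [integral_add hF hF.comp_neg, h1]
    ring
  change ∫ t, F t = _
  rw [h2, ← integral_const_mul]
  refine integral_congr_ae (Eventually.of_forall fun t => ?_)
  simp only [F, trapezoidKernel_neg]
  push_cast
  rw [Complex.cos]
  ring_nf

lemma integral_trapezoidKernel_mul_exp_of_le {a b : ℝ} (hab : a < b) {x : ℝ} (hx : 0 ≤ x)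
    (hxa : x ≤ a) :
    ∫ t, (trapezoidKernel a b t : ℂ) * Complex.exp ((x * t : ℝ) * Complex.I) = 1 := by
  rw [integral_trapezoidKernel_mul_exp (hx.trans hxa) hab hx, abs_of_nonneg (by linarith),
    abs_of_nonneg (by linarith)]
  have : b - a ≠ 0 := (sub_pos.2 hab).ne'
  norm_cast
  field_simp
  ring

lemma integral_trapezoidKernel_mul_exp_of_ge {a b : ℝ} (ha : 0 ≤ a) (hab : a < b) {x : ℝ}
    (hbx : b ≤ x) :
    ∫ t, (trapezoidKernel a b t : ℂ) * Complex.exp ((x * t : ℝ) * Complex.I) = 0 := by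
  rw [integral_trapezoidKernel_mul_exp ha hab (by linarith), abs_of_nonpos (by linarith),
    abs_of_nonpos (by linarith)]
  norm_cast
  ring

/-! ### The `L₁` norm of the trapezoidal kernel -/

lemma abs_cos_sub_cos_eq (a b t : ℝ) :
    |Real.cos (a * t) - Real.cos (b * t)|
      = 2 * |Real.sin ((a + b) / 2 * t)| * |Real.sin ((b - a) / 2 * t)| := by
  rw [Real.cos_sub_cos, abs_mul, abs_mul, abs_neg, abs_two,
    show (a * t + b * t) / 2 = (a + b) / 2 * t by ring,
    show (a * t - b * t) / 2 = -((b - a) / 2 * t) by ring, Real.sin_neg, abs_neg]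

/-- Write the numerator as a product of two sines and cut at `1/(a+b)` and `1/(b-a)`. Near `0` both
sines are bounded by their arguments, contributing `(b-a)/2`; in the middle only the slower one is,
leaving `(b-a)/t` and hence the logarithm; the tail is at most `2/t²`, contributing `2(b-a)`. -/
lemma integral_Ioi_abs_cos_sub_cos_div_sq_le {a b : ℝ} (ha : 0 ≤ a) (hab : a < b) :
    ∫ t in Set.Ioi (0 : ℝ), |Real.cos (a * t) - Real.cos (b * t)| / t ^ 2
      ≤ (b - a) * (5 / 2 + Real.log ((a + b) / (b - a))) := by
  have hd : 0 < b - a := sub_pos.2 hab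
  have hs : 0 < a + b := by linarith
  set g : ℝ → ℝ := fun t => |Real.cos (a * t) - Real.cos (b * t)| / t ^ 2
  have hg : Integrable g :=
    (integrable_cos_sub_cos_div_sq a b).norm.congr (Eventually.of_forall fun t => by simp [g])
  have hu : 0 < (a + b)⁻¹ := inv_pos.2 hs
  have hv : 0 < (b - a)⁻¹ := inv_pos.2 hd
  have huv : (a + b)⁻¹ ≤ (b - a)⁻¹ := inv_anti₀ hd (by linarith)
  have b1 : ∀ t, 0 < t → g t ≤ (a + b) * (b - a) / 2 := fun t ht => by
    simp only [g]
    rw [div_le_iff₀ (pow_pos ht 2), abs_cos_sub_cos_eq]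
    have h1 := Real.abs_sin_le_abs (x := (a + b) / 2 * t)
    have h2 := Real.abs_sin_le_abs (x := (b - a) / 2 * t)
    rw [abs_of_pos (a := _ * t) (by positivity)] at h1 h2
    calc _ ≤ 2 * ((a + b) / 2 * t) * ((b - a) / 2 * t) := by gcongr
      _ = _ := by ring
  have b2 : ∀ t, 0 < t → g t ≤ (b - a) * (1 / t) := fun t ht => by
    simp only [g]
    rw [div_le_iff₀ (pow_pos ht 2), abs_cos_sub_cos_eq]
    have h1 := Real.abs_sin_le_one ((a + b) / 2 * t)
    have h2 := Real.abs_sin_le_abs (x := (b - a) / 2 * t)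
    rw [abs_of_pos (a := _ * t) (by positivity)] at h2
    calc _ ≤ 2 * 1 * ((b - a) / 2 * t) := by gcongr
      _ = _ := by field_simp
  have b3 : ∀ t, 0 < t → g t ≤ 2 * t ^ (-2 : ℝ) := fun t ht => by
    simp only [g]
    rw [Real.rpow_neg ht.le, Real.rpow_two, ← div_eq_mul_inv]
    gcongr
    exact (abs_sub _ _).trans (by linarith [Real.abs_cos_le_one (a * t), Real.abs_cos_le_one (b * t)])
  have i1 : ∫ t in (0 : ℝ)..(a + b)⁻¹, g t ≤ (b - a) / 2 := by
    refine (intervalIntegral.integral_mono_on_of_le_Ioo hu.le hg.intervalIntegrable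
      (intervalIntegrable_const (c := (a + b) * (b - a) / 2)) fun t ht => b1 t ht.1).trans ?_
    rw [intervalIntegral.integral_const, smul_eq_mul, sub_zero]
    field_simp
    rfl
  have i2 : ∫ t in (a + b)⁻¹..(b - a)⁻¹, g t ≤ (b - a) * Real.log ((a + b) / (b - a)) := by
    have hint : IntervalIntegrable (fun t : ℝ => (b - a) * (1 / t)) volume (a + b)⁻¹ (b - a)⁻¹ := by
      refine ContinuousOn.intervalIntegrable_of_Icc huv fun t ht => ?_
      have : t ≠ 0 := (hu.trans_le ht.1).ne'
      exact ContinuousAt.continuousWithinAt (by fun_prop (disch := assumption))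
    refine (intervalIntegral.integral_mono_on huv hg.intervalIntegrable hint
      fun t ht => b2 t (hu.trans_le ht.1)).trans ?_
    rw [intervalIntegral.integral_const_mul, integral_one_div_of_pos hu hv, inv_div_inv]
  have i3 : ∫ t in Set.Ioi (b - a)⁻¹, g t ≤ 2 * (b - a) := by
    refine (setIntegral_mono_on hg.integrableOn
      ((integrableOn_Ioi_rpow_of_lt (by norm_num) hv).const_mul 2) measurableSet_Ioi
      fun t ht => b3 t (hv.trans ht)).trans ?_
    rw [integral_const_mul, integral_Ioi_rpow_of_lt (by norm_num) hv]
    norm_num [Real.rpow_neg_one]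
    linarith
  rw [← intervalIntegral.integral_interval_add_Ioi hg.integrableOn
      (b := (b - a)⁻¹) hg.integrableOn,
    ← intervalIntegral.integral_add_adjacent_intervals (b := (a + b)⁻¹)
      hg.intervalIntegrable hg.intervalIntegrable]
  linarith

lemma integral_norm_trapezoidKernel_le {a b : ℝ} (ha : 0 ≤ a) (hab : a < b) :
    ∫ t, ‖(trapezoidKernel a b t : ℂ)‖
      ≤ 2 / fejerMass * (5 / 2 + Real.log ((a + b) / (b - a))) := by
  have hd : 0 < b - a := sub_pos.2 hab
  have hK := fejerMass_pos
  have e : ∀ t, ‖(trapezoidKernel a b t : ℂ)‖ =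
      |Real.cos (a * |t|) - Real.cos (b * |t|)| / |t| ^ 2 / (fejerMass * (b - a)) := fun t => by
    rw [Complex.norm_real, Real.norm_eq_abs, trapezoidKernel, abs_div, abs_div,
      abs_of_pos (mul_pos hK hd), abs_of_nonneg (sq_nonneg t), sq_abs]
    rcases abs_choice t with h | h <;> simp [h]
  simp_rw [e]
  rw [integral_div,
    integral_comp_abs (f := fun t => |Real.cos (a * t) - Real.cos (b * t)| / t ^ 2),
    div_le_iff₀ (mul_pos hK hd)]
  refine (mul_le_mul_of_nonneg_left (integral_Ioi_abs_cos_sub_cos_div_sq_le ha hab)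
    zero_le_two).trans (le_of_eq ?_)
  field_simp

/-! ### Convolution along the one-parameter subgroup of a Dirichlet group -/

section Convolution

variable {lam : ℕ → ℝ} {G : Type*} [CommGroup G] [TopologicalSpace G] [IsTopologicalGroup G]
  [CompactSpace G] [MeasurableSpace G] [BorelSpace G]

/-- The flow `t ↦ β(t)` of a Dirichlet group, as a function on `ℝ`. -/
def DirichletGroup.flow (B : DirichletGroup lam G) (t : ℝ) : G := B.β (Multiplicative.ofAdd t)

omit [IsTopologicalGroup G] [CompactSpace G] [MeasurableSpace G] [BorelSpace G] in
omit [IsTopologicalGroup G] [CompactSpace G] [MeasurableSpace G] [BorelSpace G] in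
lemma DirichletGroup.continuous_flow (B : DirichletGroup lam G) : Continuous B.flow :=
  (map_continuous B.β).comp continuous_ofAdd

/-- The convolution `ω ↦ ∫ φ(t) f(ω β(t)⁻¹) dt`. -/
def flowConv (B : DirichletGroup lam G) (φ : ℝ → ℂ) (f : G → ℂ) (ω : G) : ℂ :=
  ∫ t, φ t * f (ω * (B.flow t)⁻¹)

/-- Each fibre of this shear is a Haar-preserving translation. It transfers integrability and null
sets from `(t, ω) ↦ f ω` to `(t, ω) ↦ f (ω β(t)⁻¹)`, as needed when `f` is known only almost
everywhere. -/
lemma measurePreserving_flow (B : DirichletGroup lam G) :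
    MeasurePreserving (fun z : ℝ × G => (z.1, z.2 * (B.flow z.1)⁻¹))
      ((volume : Measure ℝ).prod (haarProb G)) ((volume : Measure ℝ).prod (haarProb G)) := by
  refine (MeasurePreserving.id volume).skew_product (g := fun t ω => ω * (B.flow t)⁻¹) ?_
    (Eventually.of_forall fun t => map_mul_right_eq_self _ _)
  have h : Continuous fun z : ℝ × G => z.2 * (B.flow z.1)⁻¹ :=
    continuous_snd.mul (B.continuous_flow.comp continuous_fst).inv
  exact h.measurable

lemma integrable_flowConv_integrand (B : DirichletGroup lam G) {φ : ℝ → ℂ} (hφ : Integrable φ)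
    {f : G → ℂ} (hf : Integrable f (haarProb G)) :
    Integrable (fun z : ℝ × G => φ z.1 * f (z.2 * (B.flow z.1)⁻¹))
      ((volume : Measure ℝ).prod (haarProb G)) :=
  (measurePreserving_flow B).integrable_comp_of_integrable (hφ.mul_prod hf)

lemma integrable_flowConv (B : DirichletGroup lam G) {φ : ℝ → ℂ} (hφ : Integrable φ)
    {f : G → ℂ} (hf : Integrable f (haarProb G)) :
    Integrable (flowConv B φ f) (haarProb G) :=
  (integrable_flowConv_integrand B hφ hf).integral_prod_right

/-- Fubini, and translation invariance of the inner integral over `G`. -/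
lemma integral_norm_flowConv_le (B : DirichletGroup lam G) {φ : ℝ → ℂ} (hφ : Integrable φ)
    {f : G → ℂ} (hf : Integrable f (haarProb G)) :
    ∫ ω, ‖flowConv B φ f ω‖ ∂(haarProb G) ≤ (∫ t, ‖φ t‖) * ∫ ω, ‖f ω‖ ∂(haarProb G) := by
  have hF := (integrable_flowConv_integrand B hφ hf).norm
  calc ∫ ω, ‖flowConv B φ f ω‖ ∂(haarProb G)
      ≤ ∫ ω, (∫ t, ‖φ t * f (ω * (B.flow t)⁻¹)‖) ∂(haarProb G) :=
        integral_mono (integrable_flowConv B hφ hf).norm hF.integral_prod_right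
          fun ω => norm_integral_le_integral_norm _
    _ = ∫ t, ∫ ω, ‖φ t * f (ω * (B.flow t)⁻¹)‖ ∂(haarProb G) :=
        (integral_integral_swap (f := fun t ω => ‖φ t * f (ω * (B.flow t)⁻¹)‖) hF).symm
    _ = _ := by
        simp only [norm_mul, integral_const_mul]
        rw [← integral_mul_const]
        refine integral_congr_ae (Eventually.of_forall fun t => ?_)
        simp only
        rw [integral_mul_right_eq_self (fun ω => ‖f ω‖)]

/-- The exceptional null set of `f` pulls back under the shear to a null set of the product, almost
all of whose sections are null in `t`. -/
lemma ae_norm_flowConv_le (B : DirichletGroup lam G) {φ : ℝ → ℂ} (hφ : Integrable φ)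
    {f : G → ℂ} {M : ℝ} (hM : ∀ᵐ ω ∂(haarProb G), ‖f ω‖ ≤ M) :
    ∀ᵐ ω ∂(haarProb G), ‖flowConv B φ f ω‖ ≤ (∫ t, ‖φ t‖) * M := by
  have h1 : ∀ᵐ z ∂((haarProb G).prod (volume : Measure ℝ)),
      ‖f (z.1 * (B.flow z.2)⁻¹)‖ ≤ M :=
    ((Measure.quasiMeasurePreserving_snd.comp
      (measurePreserving_flow B).quasiMeasurePreserving).comp
      Measure.measurePreserving_swap.quasiMeasurePreserving).ae hM
  filter_upwards [Measure.ae_ae_of_ae_prod h1] with ω hω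
  refine (norm_integral_le_of_norm_le (hφ.norm.mul_const M) ?_).trans_eq (integral_mul_const _ _)
  filter_upwards [hω] with t ht
  rw [norm_mul]
  gcongr

/-- After Fubini, replacing `ω` by `ω β(t)` splits off the factor `conj (γ (β(t)))`. The convolution
is therefore a Fourier multiplier and cannot enlarge the spectrum of `f`. -/
lemma fourierCoeff_flowConv (B : DirichletGroup lam G) {φ : ℝ → ℂ} (hφ : Integrable φ)
    {f : G → ℂ} (hf : Integrable f (haarProb G)) (γ : PontryaginDual G) :
    fourierCoeff (flowConv B φ f) γ
      = (∫ t, φ t * conj (γ (B.flow t) : ℂ)) * fourierCoeff f γ := by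
  have hF : Integrable (fun z : ℝ × G => φ z.1 * f (z.2 * (B.flow z.1)⁻¹) * conj (γ z.2 : ℂ))
      ((volume : Measure ℝ).prod (haarProb G)) := by
    refine (integrable_flowConv_integrand B hφ hf).mul_bdd (c := 1) ?_
      (Eventually.of_forall fun z => by rw [RCLike.norm_conj, norm_char])
    exact ((Complex.continuous_conj.comp (continuous_char γ)).comp
      continuous_snd).aestronglyMeasurable
  calc fourierCoeff (flowConv B φ f) γ
      = ∫ ω, (∫ t, φ t * f (ω * (B.flow t)⁻¹) * conj (γ ω : ℂ)) ∂(haarProb G) := by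
        simp only [fourierCoeff, flowConv, integral_mul_const]
    _ = ∫ t, ∫ ω, φ t * f (ω * (B.flow t)⁻¹) * conj (γ ω : ℂ) ∂(haarProb G) :=
        (integral_integral_swap
          (f := fun t ω => φ t * f (ω * (B.flow t)⁻¹) * conj (γ ω : ℂ)) hF).symm
    _ = _ := by
        rw [← integral_mul_const]
        refine integral_congr_ae (Eventually.of_forall fun t => ?_)
        simp only
        rw [fourierCoeff, ← integral_mul_right_eq_self _ (B.flow t), ← integral_const_mul]
        refine integral_congr_ae (Eventually.of_forall fun ω => ?_)
        simp only [mul_inv_cancel_right, map_mul, Circle.coe_mul]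
        ring

lemma exists_lp_flowConv (B : DirichletGroup lam G) {φ : ℝ → ℂ} (hφ : Integrable φ)
    (p : ℝ≥0∞) [Fact (1 ≤ p)] (hp : p = 1 ∨ p = ∞) (f : Lp ℂ p (haarProb G)) :
    ∃ g : Lp ℂ p (haarProb G), g =ᵐ[haarProb G] flowConv B φ f ∧
      ‖g‖ ≤ (∫ t, ‖φ t‖) * ‖f‖ := by
  have hfi : Integrable f (haarProb G) := (Lp.memLp f).integrable Fact.out
  have hci := integrable_flowConv B hφ hfi
  have hφ0 : 0 ≤ ∫ t, ‖φ t‖ := integral_nonneg fun _ => norm_nonneg _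
  rcases hp with rfl | rfl
  · refine ⟨hci.toL1 _, hci.coeFn_toL1, ?_⟩
    have h := integral_norm_flowConv_le B hφ hfi
    rw [L1.norm_eq_integral_norm f, L1.norm_eq_integral_norm]
    refine le_trans (le_of_eq (integral_congr_ae ?_)) h
    filter_upwards [hci.coeFn_toL1] with ω hω
    rw [hω]
  · have hb : ∀ᵐ ω ∂(haarProb G), ‖flowConv B φ f ω‖ ≤ (∫ t, ‖φ t‖) * ‖f‖ :=
      ae_norm_flowConv_le B hφ (by
        filter_upwards [ae_le_eLpNormEssSup (f := f) (μ := haarProb G)] with ω hω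
        rw [← eLpNorm_exponent_top] at hω
        simpa [Lp.norm_def] using ENNReal.toReal_mono (Lp.eLpNorm_ne_top f) hω)
    have hm : MemLp (flowConv B φ f) ∞ (haarProb G) := memLp_top_of_bound hci.1 _ hb
    refine ⟨hm.toLp _, hm.coeFn_toLp, ?_⟩
    rw [Lp.norm_toLp]
    refine ENNReal.toReal_le_of_le_ofReal (by positivity) ?_
    rw [eLpNorm_exponent_top]
    exact eLpNormEssSup_le_of_ae_bound hb

lemma fourierCoeff_congr_ae {f g : G → ℂ} (h : f =ᵐ[haarProb G] g) (γ : PontryaginDual G) :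
    fourierCoeff f γ = fourierCoeff g γ :=
  integral_congr_ae (by filter_upwards [h] with ω hω; rw [hω])

/-- If `φ̂` is `1` at the frequencies up to `lam N` and `0` at the later ones, then `‖φ‖₁` bounds the
norm of the `N`-th partial sum operator. -/
lemma norm_partialSum_le_of_kernel (hlam : Function.Injective lam) (B : DirichletGroup lam G)
    (p : ℝ≥0∞) [Fact (1 ≤ p)] (hp : p = 1 ∨ p = ∞) (N : ℕ) {φ : ℝ → ℂ} (hφ : Integrable φ)
    (h : ∀ n, ∫ t, φ t * Complex.exp ((lam n * t : ℝ) * Complex.I) = if n ≤ N then 1 else 0) :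
    ‖HardySpace.partialSum B p N‖ ≤ ∫ t, ‖φ t‖ := by
  have hφ0 : 0 ≤ ∫ t, ‖φ t‖ := integral_nonneg fun _ => norm_nonneg _
  refine ContinuousLinearMap.opNorm_le_bound _ hφ0 fun D => ?_
  have key : ∀ f : lamHardy B p,
      ‖HardySpace.partialSum B p N (HardySpace.ofFun B p f)‖ ≤ (∫ t, ‖φ t‖) * ‖f‖ := by
    intro f
    obtain ⟨g, hg, hgn⟩ := exists_lp_flowConv B hφ p hp (f : Lp ℂ p (haarProb G))
    have hfi : Integrable (f : G → ℂ) (haarProb G) :=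
      (Lp.memLp (f : Lp ℂ p (haarProb G))).integrable Fact.out
    have hc : ∀ γ, fourierCoeff (g : G → ℂ) γ
        = (∫ t, φ t * conj (γ (B.flow t) : ℂ)) * fourierCoeff (f : G → ℂ) γ := fun γ => by
      rw [fourierCoeff_congr_ae hg, fourierCoeff_flowConv B hφ hfi]
    have hgm : g ∈ lamHardy B p := fun γ hγ =>
      f.2 γ fun h0 => hγ (by rw [hc, h0, mul_zero])
    have he : HardySpace.partialSum B p N (HardySpace.ofFun B p f)
        = HardySpace.ofFun B p ⟨g, hgm⟩ := by
      refine HardySpace.ext fun n => ?_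
      rw [HardySpace.coeff_partialSum B p hlam, HardySpace.coeff_ofFun, HardySpace.coeff_ofFun]
      refine Eq.trans ?_ (hc (B.char n)).symm
      have hn : ∀ t, conj (B.char n (B.flow t) : ℂ)
          = Complex.exp ((lam n * t : ℝ) * Complex.I) := fun t => by
        rw [DirichletGroup.flow, B.char_spec, Circle.coe_exp, ← Complex.exp_conj]
        simp
      simp_rw [hn]
      rw [h n]
      split_ifs <;> simp
    rw [he]
    exact ((HardySpace.isGLB_norm B p _).1 ⟨⟨g, hgm⟩, rfl, rfl⟩).trans hgn
  -- The norm of `D` is an infimum over representatives `f`. The bound for each `f` passes to it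
  -- after division by `‖φ‖₁`, so the value `0` is treated apart.
  rcases hφ0.eq_or_lt with h0 | h0
  · obtain ⟨f, rfl⟩ := HardySpace.ofFun_surjective B p D
    simpa [← h0] using key f
  · rw [← div_le_iff₀' h0]
    refine (le_isGLB_iff (HardySpace.isGLB_norm B p D)).2 ?_
    rintro r ⟨f, rfl, rfl⟩
    exact (div_le_iff₀' h0).2 (key f)

/-- Any `b` in the gap serves, not only the next frequency; placing it at a known lower bound for
the gap makes the logarithm explicit. -/
lemma norm_partialSum_le_log (hlam : IsFrequency lam) (B : DirichletGroup lam G)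
    (p : ℝ≥0∞) [Fact (1 ≤ p)] (hp : p = 1 ∨ p = ∞) (N : ℕ) {b : ℝ} (hb : lam N < b)
    (hb' : b ≤ lam (N + 1)) :
    ‖HardySpace.partialSum B p N‖
      ≤ 2 / fejerMass * (5 / 2 + Real.log ((lam N + b) / (b - lam N))) := by
  refine (norm_partialSum_le_of_kernel hlam.strictMono.injective B p hp N
    (integrable_ofReal_trapezoidKernel (lam N) b) fun n => ?_).trans
    (integral_norm_trapezoidKernel_le (hlam.nonneg N) hb)
  split_ifs with hn
  · exact integral_trapezoidKernel_mul_exp_of_le hb (hlam.nonneg n) (hlam.strictMono.monotone hn)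
  · exact integral_trapezoidKernel_mul_exp_of_ge (hlam.nonneg N) hb
      (hb'.trans (hlam.strictMono.monotone (by omega)))

/-- If the gap after `lam N` is at least `c e^{-E}` with `c ≤ 1` and `0 ≤ E`, the norm of the `N`-th
partial sum operator is bounded linearly in `lam N + E`. -/
lemma norm_partialSum_le_of_gap (hlam : IsFrequency lam) (B : DirichletGroup lam G)
    (p : ℝ≥0∞) [Fact (1 ≤ p)] (hp : p = 1 ∨ p = ∞) (N : ℕ) {c E : ℝ} (hc : 0 < c) (hc1 : c ≤ 1)
    (hE : 0 ≤ E) (hgap : c * Real.exp (-E) ≤ lam (N + 1) - lam N) :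
    ‖HardySpace.partialSum B p N‖
      ≤ 2 / fejerMass * (5 / 2 - Real.log c + 2 * lam N + E) := by
  have hK := fejerMass_pos
  have hN := hlam.nonneg N
  have hd : 0 < c * Real.exp (-E) := by positivity
  have hd1 : c * Real.exp (-E) ≤ 1 :=
    mul_le_one₀ hc1 (Real.exp_pos _).le (Real.exp_le_one_iff.2 (by linarith))
  refine (norm_partialSum_le_log hlam B p hp N (b := lam N + c * Real.exp (-E)) (by linarith)
    (by linarith)).trans ?_
  -- From `log x ≤ x - 1`: the `-1` absorbs `c e^{-E} ≤ 1`.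
  have h1 : Real.log (lam N + (lam N + c * Real.exp (-E))) ≤ 2 * lam N := by
    refine (Real.log_le_sub_one_of_pos (by linarith)).trans (by linarith)
  rw [add_sub_cancel_left, Real.log_div (by linarith) hd.ne', Real.log_mul hc.ne'
    (Real.exp_pos _).ne', Real.log_exp]
  refine mul_le_mul_of_nonneg_left ?_ (by positivity)
  linarith

end Convolution

end

end GeneralDirichlet

/-! ### Bohr's and Landau's conditions -/

theorem mainTheorem10 (lam : ℕ → ℝ) (hlam : IsFrequency lam) :
    (BohrCondition lam →
      ∃ C : ℝ, 0 < C ∧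
        ∀ (p : ℝ≥0∞) [Fact (1 ≤ p)], p = 1 ∨ p = ∞ →
        ∀ (G : Type*) [CommGroup G] [TopologicalSpace G] [IsTopologicalGroup G] [CompactSpace G]
          [T2Space G] [MeasurableSpace G] [BorelSpace G] (B : DirichletGroup lam G) (N : ℕ),
          0 < lam N → ‖HardySpace.partialSum B p N‖ ≤ C * lam N) ∧
    (LandauCondition lam → stripWidth lam < ⊤ →
      ∀ δ : ℝ, 0 < δ → ∃ C₁ : ℝ, 0 < C₁ ∧
        ∀ (p : ℝ≥0∞) [Fact (1 ≤ p)], p = 1 ∨ p = ∞ →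
        ∀ (G : Type*) [CommGroup G] [TopologicalSpace G] [IsTopologicalGroup G] [CompactSpace G]
          [T2Space G] [MeasurableSpace G] [BorelSpace G] (B : DirichletGroup lam G) (N : ℕ),
          ‖HardySpace.partialSum B p N‖ ≤ C₁ * Real.exp (δ * lam N)) := by
  have hK := fejerMass_pos
  constructor
  · rintro ⟨l, hl, hbc⟩
    obtain ⟨C, hC, hgap⟩ := hbc 1 one_pos
    -- The smallest positive frequency `m` lets a constant be absorbed as `K ≤ (K/m) λ_N`.
    obtain ⟨m, hm, hmin⟩ : ∃ m, 0 < m ∧ ∀ N, 0 < lam N → m ≤ lam N := by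
      refine ⟨if 0 < lam 0 then lam 0 else lam 1, ?_, fun N hN => ?_⟩
      · split_ifs with h
        · exact h
        · exact (hlam.nonneg 0).trans_lt (hlam.strictMono one_pos)
      · split_ifs with h
        · exact hlam.strictMono.monotone N.zero_le
        · refine hlam.strictMono.monotone (Nat.one_le_iff_ne_zero.2 ?_)
          rintro rfl
          exact h hN
    -- Shrinking the constant to at most `1` keeps the gap bound and makes `-log` of it nonnegative.
    have hc : 0 < min C 1 := lt_min hC one_pos
    have hlog : 0 ≤ -Real.log (min C 1) :=
      neg_nonneg.2 (Real.log_nonpos hc.le (min_le_right _ _))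
    refine ⟨2 / fejerMass * ((5 / 2 - Real.log (min C 1)) / m + 2 + (l + 1)), ?_, ?_⟩
    · have : 0 < 5 / 2 - Real.log (min C 1) := by linarith
      positivity
    · intro p _ hp G _ _ _ _ _ _ _ B N hN
      refine (norm_partialSum_le_of_gap hlam B p hp N hc (min_le_right C 1)
        (E := (l + 1) * lam N) (by positivity) ?_).trans ?_
      · refine le_trans ?_ (hgap N)
        rw [neg_mul]
        exact mul_le_mul_of_nonneg_right (min_le_left _ _) (Real.exp_pos _).le
      · have h1 : 5 / 2 - Real.log (min C 1)
            ≤ (5 / 2 - Real.log (min C 1)) / m * lam N := by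
          rw [div_mul_eq_mul_div, le_div_iff₀ hm]
          exact mul_le_mul_of_nonneg_left (hmin N hN) (by linarith)
        rw [mul_assoc, add_mul, add_mul]
        refine mul_le_mul_of_nonneg_left ?_ (by positivity)
        linarith
  · intro hlc _ δ hδ
    -- The target `δ` itself works in (LC): the bound is linear in `E = e^{δλ_N}`, and both `λ_N`
    -- and the constants are dominated by multiples of `e^{δλ_N}`.
    obtain ⟨C, hC, hgap⟩ := hlc δ hδ
    have hc : 0 < min C 1 := lt_min hC one_pos
    have hlog : 0 ≤ -Real.log (min C 1) :=
      neg_nonneg.2 (Real.log_nonpos hc.le (min_le_right _ _))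
    refine ⟨2 / fejerMass * (5 / 2 - Real.log (min C 1) + 2 / δ + 1), ?_, ?_⟩
    · have : 0 < 5 / 2 - Real.log (min C 1) := by linarith
      positivity
    · intro p _ hp G _ _ _ _ _ _ _ B N
      refine (norm_partialSum_le_of_gap hlam B p hp N hc (min_le_right C 1)
        (E := Real.exp (δ * lam N)) (Real.exp_pos _).le ?_).trans ?_
      · refine le_trans ?_ (hgap N)
        exact mul_le_mul_of_nonneg_right (min_le_left _ _) (Real.exp_pos _).le
      · have h1 : δ * lam N + 1 ≤ Real.exp (δ * lam N) := Real.add_one_le_exp _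
        have h2 : 0 ≤ δ * lam N := mul_nonneg hδ.le (hlam.nonneg N)
        have h3 : 2 * lam N ≤ 2 / δ * Real.exp (δ * lam N) := by
          rw [div_mul_eq_mul_div, le_div_iff₀ hδ]
          linarith
        have h4 : 5 / 2 - Real.log (min C 1)
            ≤ (5 / 2 - Real.log (min C 1)) * Real.exp (δ * lam N) :=
          le_mul_of_one_le_right (by linarith) (by linarith)
        rw [mul_assoc, add_mul, add_mul, one_mul]
        refine mul_le_mul_of_nonneg_left ?_ (by positivity)
        linarith
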